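/- Theorem. For $n\ge 1$ let $X_n=\{1,\dots,n\}\times\mathbb N$ be the disjoint union of $n$ copies (rays) of $\mathbb N$. Houghton's group $\mathcal H_n$ is the group of all bijections $g:X_n\to X_n$ for which there are $(m_1,\dots,m_n)\in\mathbb Z^n$ and a finite set $K_g\subset X_n$ such that $g(k,p)=(k,p+m_k)$ for all $(k,p)\in X_n\setminus K_g$. For a group $G$ with a finite generating set $A$, let $|g|_A$ denote the minimum length of a word over $A\cup A^{-1}$ that represents $g\in G$, and for an endomorphism $\phi$ of $G$ let $$\mathrm{GR}_A(\phi)=\sup\Bigl\{\limsup_{k\to\infty}|\phi^k(g)|_A^{1/k} : g\in G\Bigr\}\in[0,\infty].$$ Let $n\ge 3$ and let $\phi$ be an automorphism of $\mathcal H_n$. Then $\mathcal H_n$ is finitely generated, and $\mathrm{GR}_A(\phi)=1$ for every finite generating set $A$ of $\mathcal H_n$. -/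

import Mathlib

open Filter
open scoped ENNReal

namespace Houghton

/-- The word length of `g` over `A ∪ A⁻¹`: the least length of a word in the elements of `A` and
their inverses that represents `g`. (It is used only for sets `A` that generate the group.) -/
noncomputable def wordLength {G : Type*} [Group G] (A : Set G) (g : G) : ℕ :=
  sInf {m : ℕ | ∃ w : List G, (∀ x ∈ w, x ∈ A ∨ x⁻¹ ∈ A) ∧ w.prod = g ∧ w.length = m}

/-- The growth rate of an endomorphism `φ`, computed with the generating set `A`:
`sup_g limsup_k |φ^k(g)|^(1/k)`. It takes values in `[0, ∞]`, where every limsup and every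
supremum exists. -/
noncomputable def growthRate {G : Type*} [Group G] (A : Set G) (φ : G →* G) : ℝ≥0∞ :=
  ⨆ g : G, limsup (fun k : ℕ => (wordLength A (φ^[k] g) : ℝ≥0∞) ^ (1 / (k : ℝ))) atTop

/-- The disjoint union of `n` copies of `ℕ`; `(k, p)` is the point number `p` of the ray `k`
(rays and points are both numbered from `0`). -/
abbrev Rays (n : ℕ) : Type := Fin n × ℕ

/-- `g` is an eventual translation: there are `m ∈ ℤⁿ` and a finite set `K` of points such that
`g (k, p) = (k, p + m k)` for all points `(k, p)` outside `K`. -/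
def IsEventualTranslation {n : ℕ} (g : Equiv.Perm (Rays n)) : Prop :=
  ∃ (m : Fin n → ℤ) (K : Set (Rays n)), K.Finite ∧
    ∀ k p, (k, p) ∉ K → (g (k, p)).1 = k ∧ ((g (k, p)).2 : ℤ) = (p : ℤ) + m k

/-- The Houghton group `H_n`: all eventual translations of `n` rays. -/
def houghtonGroup (n : ℕ) : Subgroup (Equiv.Perm (Rays n)) where
  carrier := {g | IsEventualTranslation g}
  one_mem' := ⟨0, ∅, Set.finite_empty, fun k p _ => by simp⟩
  mul_mem' := by
    rintro g h ⟨m, K, hK, hg⟩ ⟨m', K', hK', hh⟩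
    refine ⟨m + m', K' ∪ h ⁻¹' K, hK'.union (hK.preimage h.injective.injOn), fun k p hkp => ?_⟩
    rw [Set.mem_union, not_or] at hkp
    obtain ⟨h1, h2⟩ := hh k p hkp.1
    obtain ⟨h3, h4⟩ := hg (h (k, p)).1 (h (k, p)).2 hkp.2
    rw [Equiv.Perm.mul_apply]
    refine ⟨h3.trans h1, ?_⟩
    have h5 : ((g (h (k, p))).2 : ℤ) = ((h (k, p)).2 : ℤ) + m (h (k, p)).1 := h4
    rw [Pi.add_apply, h5, h1, h2]
    ring
  inv_mem' := by
    rintro g ⟨m, K, hK, hg⟩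
    refine ⟨-m, g '' K, hK.image g, fun k p hkp => ?_⟩
    have hx : g⁻¹ (k, p) ∉ K := fun hmem => hkp ⟨_, hmem, g.apply_symm_apply (k, p)⟩
    obtain ⟨h1, h2⟩ := hg (g⁻¹ (k, p)).1 (g⁻¹ (k, p)).2 hx
    have hgx : g ((g⁻¹ (k, p)).1, (g⁻¹ (k, p)).2) = (k, p) := g.apply_symm_apply (k, p)
    rw [hgx] at h1 h2
    refine ⟨h1.symm, ?_⟩
    have h3 : (p : ℤ) = ((g⁻¹ (k, p)).2 : ℤ) + m (g⁻¹ (k, p)).1 := h2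
    have h4 : k = (g⁻¹ (k, p)).1 := h1
    rw [← h4] at h3
    rw [Pi.neg_apply]
    linarith

end Houghton

/-! Some power of every automorphism is inner, and an automorphism with an inner power stretches
word length at most linearly along orbits.

Transpositions can be recognised algebraically. The product of a transposition with any of its
conjugates has order dividing 6. An involution with a fixed point and a second 2-cycle fails this: a
suitable 5-cycle conjugates it so that the product has a 5-cycle. Involutions of the Houghton group
do have fixed points, so automorphisms preserve transpositions (`isSwap_map`). Hence each one is
conjugation by a permutation `f` of the points (`exists_conj_of_isSwap_iff`).

Such an `f` normalizes the group. It carries translations along a ray to eventual translations, so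
it is eventually affine on each ray; applying this to `f⁻¹` as well forces slope 1 and a permutation
`σ` of the rays (`exists_permutesRays`). Thus `f ^ orderOf σ` lies in the group.

Linear growth bounds the rate by 1, and iterates of a nontrivial element have length at least 1, so
the rate is exactly 1. -/

namespace Houghton

open Equiv

/-! ### Transpositions and automorphisms of permutation groups -/

section Permutations

variable {α : Type*} [DecidableEq α]

/-- For distinct points, the braid relation `(ab)(ad)(ab) = (bd) = (ad)(ab)(ad)` makes the cube
trivial; in the degenerate cases the square is. -/
theorem swap_mul_swap_same_pow_six (a b d : α) : (swap a b * swap a d) ^ 6 = 1 := by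
  by_cases hab : a = b
  · subst hab
    rw [show swap a a = 1 from swap_self a, one_mul, show 6 = 2 * 3 by rfl, pow_mul, pow_two, swap_mul_self,
      one_pow]
  by_cases had : a = d
  · subst had
    rw [show swap a a = 1 from swap_self a, mul_one, show 6 = 2 * 3 by rfl, pow_mul, pow_two, swap_mul_self,
      one_pow]
  by_cases hbd : b = d
  · rw [hbd, swap_mul_self, one_pow]
  have h1 : swap a b * swap a d * swap a b = swap b d := by
    have := swap_mul_swap_mul_swap (x := d) (y := a) (z := b) (Ne.symm had) (Ne.symm hbd)
    rwa [swap_comm d a] at this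
  have h2 : swap a d * swap a b * swap a d = swap b d := by
    have := swap_mul_swap_mul_swap (x := b) (y := a) (z := d) (Ne.symm hab) hbd
    rwa [swap_comm b a, swap_comm d b] at this
  have h3 : (swap a b * swap a d) ^ 3 = 1 := by
    calc _ = (swap a b * swap a d * swap a b) * (swap a d * swap a b * swap a d) := by
          simp only [pow_succ, pow_zero, one_mul, mul_assoc]
      _ = 1 := by rw [h1, h2, swap_mul_self]
  rw [show 6 = 3 * 2 by rfl, pow_mul, h3, one_pow]

/-- The product of two transpositions has order dividing six. -/
theorem swap_mul_swap_pow_six (a b c d : α) : (swap a b * swap c d) ^ 6 = 1 := by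
  by_cases hac : a = c
  · rw [hac]; exact swap_mul_swap_same_pow_six _ _ _
  by_cases had : a = d
  · rw [had, swap_comm c d]; exact swap_mul_swap_same_pow_six _ _ _
  by_cases hbc : b = c
  · rw [hbc, swap_comm a c]; exact swap_mul_swap_same_pow_six _ _ _
  by_cases hbd : b = d
  · rw [hbd, swap_comm a d, swap_comm c d]; exact swap_mul_swap_same_pow_six _ _ _
  have h : Commute (swap a b) (swap c d) := Perm.Disjoint.commute fun w => by
    simp only [swap_apply_def]
    grind
  rw [h.mul_pow, show 6 = 2 * 3 by rfl, pow_mul, pow_mul, pow_two, pow_two, swap_mul_self,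
    swap_mul_self, one_pow, one_mul]

/-- An involution with a fixed point, whose products with its conjugates have order dividing six,
is a transposition. -/
theorem isSwap_of_mul_conj_pow_six {G : Subgroup (Perm α)} (hG : ∀ x y, swap x y ∈ G)
    {t : Perm α} (h1 : t ≠ 1) (h2 : t * t = 1) {e : α} (he : t e = e)
    (h6 : ∀ u ∈ G, (t * (u * t * u⁻¹)) ^ 6 = 1) : t.IsSwap := by
  have htt : ∀ x, t (t x) = x := fun x => by rw [← Perm.mul_apply, h2, Perm.one_apply]
  obtain ⟨a, ha⟩ : ∃ a, t a ≠ a := by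
    by_contra! h
    exact h1 (Equiv.ext h)
  refine ⟨a, t a, ha.symm, ?_⟩
  by_contra hne
  obtain ⟨c, hc⟩ : ∃ c, t c ≠ swap a (t a) c := by
    by_contra! h
    exact hne (Equiv.ext h)
  obtain ⟨b, hb⟩ : ∃ b, b = t a := ⟨_, rfl⟩
  obtain ⟨d, hd⟩ : ∃ d, d = t c := ⟨_, rfl⟩
  rw [← hb] at hc ha
  have htb : t b = a := by rw [hb, htt]
  have htd : t d = c := by rw [hd, htt]
  have hca : c ≠ a := by rintro rfl; exact hc (by simp [hb])
  have hcb : c ≠ b := by rintro rfl; exact hc (by simp [htb])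
  have hdc : d ≠ c := by rw [swap_apply_of_ne_of_ne hca hcb] at hc; rw [hd]; exact hc
  have hda : d ≠ a := by rintro rfl; exact hcb (by rw [← htd, hb])
  have hdb : d ≠ b := by rintro rfl; exact hca (by rw [← htd, htb])
  have hea : e ≠ a := by rintro rfl; exact ha (by rw [hb, he])
  have heb : e ≠ b := by rintro rfl; exact ha (by rw [← htb, he])
  have hec : e ≠ c := by rintro rfl; exact hdc (by rw [hd, he])
  have hed : e ≠ d := by rintro rfl; exact hdc (by rw [← htd, he])
  -- `u` is the 5-cycle `a → b → c → d → e → a`. On these points `t` is `(a b)(c d)` and its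
  -- conjugate is `(b c)(d e)`, so the product is the 5-cycle `a → b → d → e → c → a`. Its sixth
  -- power sends `a` to `b`.
  obtain ⟨u, hu⟩ : ∃ u, u = swap a b * swap b c * swap c d * swap d e := ⟨_, rfl⟩
  have huG : u ∈ G := hu ▸ mul_mem (mul_mem (mul_mem (hG _ _) (hG _ _)) (hG _ _)) (hG _ _)
  have hua : u⁻¹ a = e := by
    rw [Perm.inv_eq_iff_eq, hu]; simp
  have hub : u⁻¹ b = a := by
    rw [Perm.inv_eq_iff_eq, hu]; simp [swap_apply_def]; grind
  have huc : u⁻¹ c = b := by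
    rw [Perm.inv_eq_iff_eq, hu]; simp [swap_apply_def]; grind
  have hud : u⁻¹ d = c := by
    rw [Perm.inv_eq_iff_eq, hu]; simp [swap_apply_def]; grind
  have hue : u⁻¹ e = d := by
    rw [Perm.inv_eq_iff_eq, hu]; simp [swap_apply_def]; grind
  have key := congrArg (fun s : Perm α => s a) (h6 u huG)
  have ua := Perm.inv_eq_iff_eq.1 hua
  have ub := Perm.inv_eq_iff_eq.1 hub
  have uc := Perm.inv_eq_iff_eq.1 huc
  have ud := Perm.inv_eq_iff_eq.1 hud
  have ue := Perm.inv_eq_iff_eq.1 hue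
  simp only [pow_succ, pow_zero, one_mul, Perm.mul_apply, Perm.one_apply, hua, hub, huc, hud, hue,
    he, ← hb, ← hd, htb, htd, ← ua, ← ub, ← uc, ← ud, ← ue] at key
  exact ha key

theorem commute_swap_iff {a b c d : α} (hab : a ≠ b) (hcd : c ≠ d) (hac : a = c) :
    Commute (swap a b) (swap c d) ↔ b = d := by
  subst hac
  constructor
  · intro h
    by_contra hbd
    have := congrArg (fun s : Perm α => s a) h.eq
    simp only [Perm.mul_apply, swap_apply_left, swap_apply_of_ne_of_ne hcd.symm (Ne.symm hbd),
      swap_apply_of_ne_of_ne hab.symm hbd] at this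
    exact hbd this.symm
  · rintro rfl
    exact Commute.refl _

/-- A transposition that moves two points exchanges them. -/
theorem _root_.Equiv.Perm.IsSwap.eq_swap {s : Perm α} (hs : s.IsSwap) {p q : α} (hp : s p ≠ p)
    (hq : s q ≠ q) (hpq : p ≠ q) : s = swap p q := by
  obtain ⟨a, b, hab, rfl⟩ := hs
  rw [swap_apply_ne_self_iff] at hp hq
  have := swap_comm a b
  grind

/-- Commuting transpositions that move a common point are equal. -/
theorem _root_.Equiv.Perm.IsSwap.eq_of_commute {s t : Perm α} (hs : s.IsSwap) (ht : t.IsSwap)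
    (h : Commute s t) {p : α} (hsp : s p ≠ p) (htp : t p ≠ p) : s = t := by
  have h1 := hs.eq_swap hsp (q := s p) (fun h => hsp (s.injective h)) hsp.symm
  have h2 := ht.eq_swap htp (q := t p) (fun h => htp (t.injective h)) htp.symm
  have h3 : Commute (swap p (s p)) (swap p (t p)) := by rwa [← h1, ← h2]
  rw [commute_swap_iff hsp.symm htp.symm rfl] at h3
  rw [h1, h2, h3]

/-- Permutations that do not commute move a common point. -/
theorem exists_of_not_commute {s t : Perm α} (h : ¬Commute s t) : ∃ p, s p ≠ p ∧ t p ≠ p := by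
  by_contra! h'
  exact h (Perm.Disjoint.commute fun x => by
    by_cases hx : s x = x
    · exact Or.inl hx
    · exact Or.inr (h' x hx))

theorem not_commute_swap {x y z : α} (hxy : x ≠ y) (hxz : x ≠ z) (hyz : y ≠ z) :
    ¬Commute (swap x y) (swap x z) := fun h =>
  hyz ((commute_swap_iff hxy hxz rfl).1 h)

theorem exists_ne_list [Infinite α] (l : List α) : ∃ x, x ∉ l := by
  obtain ⟨x, hx⟩ := Infinite.exists_notMem_finset l.toFinset
  exact ⟨x, by simpa using hx⟩

/-- An automorphism of a group of permutations that contains all transpositions and permutes them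
is the conjugation by a permutation. -/
theorem exists_conj_of_isSwap_iff [Infinite α] {G : Subgroup (Perm α)} (hG : ∀ x y, swap x y ∈ G)
    (φ : G ≃* G) (hφ : ∀ g : G, (φ g : Perm α).IsSwap ↔ (g : Perm α).IsSwap) :
    ∃ f : Perm α, ∀ g : G, (φ g : Perm α) = f * g * f⁻¹ := by
  let sw : α → α → G := fun x y => ⟨swap x y, hG x y⟩
  let T : α → α → Perm α := fun x y => (φ (sw x y) : Perm α)
  have hT : ∀ {x y}, x ≠ y → (T x y).IsSwap := fun {x y} h => (hφ _).2 ⟨x, y, h, rfl⟩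
  have hcoe : ∀ {g h : G}, Commute (φ g : Perm α) (φ h) ↔ Commute (g : Perm α) h := by
    intro g h
    constructor
    · intro hc
      have : φ (g * h) = φ (h * g) := by
        rw [map_mul, map_mul]; exact Subtype.ext hc.eq
      exact congrArg Subtype.val (φ.injective this)
    · intro hc
      have : g * h = h * g := Subtype.ext hc.eq
      have := congrArg φ this
      rw [map_mul, map_mul] at this
      exact congrArg Subtype.val this
  have hinj : ∀ {g h : G}, (φ g : Perm α) = φ h → (g : Perm α) = h := fun h =>
    congrArg Subtype.val (φ.injective (Subtype.ext h))
  -- A point is encoded by the star of transpositions moving it; the images of a star must again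
  -- share a point, which defines `f x`.
  have hstar : ∀ x, ∃ p, ∀ y, x ≠ y → T x y p ≠ p := by
    intro x
    obtain ⟨a, ha⟩ := exists_ne_list [x]
    obtain ⟨b, hb⟩ := exists_ne_list [x, a]
    simp only [List.mem_cons, List.not_mem_nil, or_false, not_or] at ha hb
    have hxa : x ≠ a := Ne.symm ha
    have hxb : x ≠ b := Ne.symm hb.1
    have hab : a ≠ b := Ne.symm hb.2
    have hnc : ∀ {y z}, x ≠ y → x ≠ z → y ≠ z → ¬Commute (T x y) (T x z) := fun h1 h2 h3 h =>
      not_commute_swap h1 h2 h3 (hcoe.1 h)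
    obtain ⟨p, hpa, hpb⟩ := exists_of_not_commute (hnc hxa hxb hab)
    refine ⟨p, fun c hxc hpc => ?_⟩
    have hca : a ≠ c := by rintro rfl; exact hpa hpc
    have hcb : b ≠ c := by rintro rfl; exact hpb hpc
    obtain ⟨q, hqa, hqc⟩ := exists_of_not_commute (hnc hxa hxc hca)
    obtain ⟨r, hrb, hrc⟩ := exists_of_not_commute (hnc hxb hxc hcb)
    have hpq : p ≠ q := by rintro rfl; exact hqc hpc
    have hpr : p ≠ r := by rintro rfl; exact hrc hpc
    have h1 : T x a = swap p q := (hT hxa).eq_swap hpa hqa hpq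
    have h2 : T x b = swap p r := (hT hxb).eq_swap hpb hrb hpr
    have hqr : q ≠ r := by
      rintro rfl
      exact hnc hxa hxb hab (by rw [h1, h2])
    have h3 : T x c = swap q r := (hT hxc).eq_swap hqc hrc hqr
    -- Without a common point the three images form a triangle on `p, q, r`. In a triangle one side
    -- conjugates another to the third, whereas `(x a)(x b)(x a) = (a b)` fixes `x` and so is not
    -- `(x c)`.
    have h4 : swap p q * swap p r * swap p q = swap q r := by
      have := swap_mul_swap_mul_swap hpr.symm hqr.symm
      rw [swap_comm p r, ← this]
    have h5 : φ (sw x a * sw x b * sw x a) = φ (sw x c) := by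
      rw [map_mul, map_mul]
      apply Subtype.ext
      change T x a * T x b * T x a = T x c
      rw [h1, h2, h3, h4]
    have h6 : swap x a * swap x b * swap x a = swap x c :=
      congrArg Subtype.val (φ.injective h5)
    have := congrArg (fun s : Perm α => s x) h6
    simp only [Perm.mul_apply, swap_apply_left, swap_apply_of_ne_of_ne hxa.symm hab] at this
    simp only [swap_apply_right] at this
    exact hxc this
  choose f hf using hstar
  have hf' : ∀ {x y}, x ≠ y → T x y (f y) ≠ f y := fun {x y} h => by
    have : T x y = T y x := by simp only [T, sw, swap_comm]
    rw [this]
    exact hf y x h.symm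
  have hfinj : Function.Injective f := by
    intro x x' hxx
    by_contra hne
    obtain ⟨y, hy⟩ := exists_ne_list [x, x']
    obtain ⟨z, hz⟩ := exists_ne_list [x, x', y]
    simp only [List.mem_cons, List.not_mem_nil, or_false, not_or] at hy hz
    have hxy : x ≠ y := Ne.symm hy.1
    have hxz : x' ≠ z := Ne.symm hz.2.1
    have hc : Commute (swap x y) (swap x' z) :=
      Perm.Disjoint.commute fun w => by
        simp only [swap_apply_def]
        grind
    have h1 := (hT hxy).eq_of_commute (hT hxz) (hcoe.2 hc) (hf x y hxy)
      (by rw [hxx]; exact hf x' z hxz)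
    have h2 : swap x y = swap x' z := hinj h1
    have := congrArg (fun s : Perm α => s x) h2
    simp only [swap_apply_left, swap_apply_of_ne_of_ne hne (Ne.symm hz.1)] at this
    exact hy.1 this
  have hTf : ∀ {x y}, x ≠ y → T x y = swap (f x) (f y) := fun {x y} h =>
    (hT h).eq_swap (hf x y h) (hf' h) (hfinj.ne h)
  have hfsurj : Function.Surjective f := by
    intro p
    obtain ⟨q, hq⟩ := exists_ne_list [p]
    have hpq : p ≠ q := fun h => hq (by simp [h])
    obtain ⟨x, y, hxy, h⟩ : ((φ.symm (sw p q) : G) : Perm α).IsSwap := by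
      rw [← hφ, MulEquiv.apply_symm_apply]
      exact ⟨p, q, hpq, rfl⟩
    have h1 : φ.symm (sw p q) = sw x y := Subtype.ext h
    have h2 : T x y = swap p q := by
      simp only [T, ← h1, MulEquiv.apply_symm_apply]
      rfl
    rw [hTf hxy] at h2
    have h3 : swap (f x) (f y) p ≠ p := by rw [h2, swap_apply_left]; exact hpq.symm
    rw [swap_apply_ne_self_iff] at h3
    rcases h3.2 with h3 | h3
    exacts [⟨x, h3.symm⟩, ⟨y, h3.symm⟩]
  let F : Perm α := Equiv.ofBijective f ⟨hfinj, hfsurj⟩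
  refine ⟨F, fun g => ?_⟩
  have hpair : ∀ x y, x ≠ y → swap ((φ g : Perm α) (f x)) ((φ g : Perm α) (f y)) =
      swap (f ((g : Perm α) x)) (f ((g : Perm α) y)) := by
    intro x y hxy
    have h1 : g * sw x y * g⁻¹ = sw ((g : Perm α) x) ((g : Perm α) y) :=
      Subtype.ext (swap_apply_apply (g : Perm α) x y).symm
    have h2 := congrArg (fun s : G => (φ s : Perm α)) h1
    simp only [map_mul, map_inv, Subgroup.coe_mul, Subgroup.coe_inv] at h2
    change (φ g : Perm α) * T x y * (φ g : Perm α)⁻¹ = T _ _ at h2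
    rw [hTf hxy, hTf ((g : Perm α).injective.ne hxy), ← swap_apply_apply] at h2
    exact h2
  rw [eq_mul_inv_iff_mul_eq]
  ext x
  change (φ g : Perm α) (f x) = f ((g : Perm α) x)
  obtain ⟨y, hy⟩ := exists_ne_list [x]
  obtain ⟨z, hz⟩ := exists_ne_list [x, y]
  simp only [List.mem_cons, List.not_mem_nil, or_false, not_or] at hy hz
  -- Each pair `{x, w}` determines the image of `f x` up to two candidates; two different choices of
  -- `w` leave only one.
  have key : ∀ w, x ≠ w → (φ g : Perm α) (f x) = f ((g : Perm α) x) ∨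
      (φ g : Perm α) (f x) = f ((g : Perm α) w) := by
    intro w hw
    have h1 : swap ((φ g : Perm α) (f x)) ((φ g : Perm α) (f w)) ((φ g : Perm α) (f x)) ≠
        (φ g : Perm α) (f x) := by
      rw [swap_apply_left]
      exact ((φ g : Perm α).injective.comp hfinj).ne hw.symm
    rw [hpair x w hw, swap_apply_ne_self_iff] at h1
    exact h1.2
  rcases key y (Ne.symm hy) with h | h
  · exact h
  · rcases key z (Ne.symm hz.1) with h' | h'
    · exact h'
    · exact absurd ((g : Perm α).injective (hfinj (h.symm.trans h'))) (Ne.symm hz.2)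

end Permutations

/-! ### Eventual translations of the rays -/

section Translations

variable {n : ℕ}

/-- `g` eventually maps the ray `k` to the ray `σ k`, by the translation by `m k`. -/
def PermutesRays (g : Perm (Rays n)) (σ : Perm (Fin n)) (m : Fin n → ℤ) : Prop :=
  ∀ k, ∀ᶠ p : ℕ in atTop, (g (k, p)).1 = σ k ∧ ((g (k, p)).2 : ℤ) = p + m k

theorem PermutesRays.one : PermutesRays (1 : Perm (Rays n)) 1 0 := fun k =>
  Eventually.of_forall fun p => by simp

theorem PermutesRays.mul {g h : Perm (Rays n)} {σ τ : Perm (Fin n)} {m m' : Fin n → ℤ}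
    (hg : PermutesRays g σ m) (hh : PermutesRays h τ m') :
    PermutesRays (g * h) (σ * τ) (fun k => m' k + m (τ k)) := by
  intro k
  obtain ⟨N, hN⟩ := eventually_atTop.1 (hg (τ k))
  filter_upwards [hh k, eventually_ge_atTop (N + (m' k).natAbs)] with p hp hpN
  have h1 : h (k, p) = (τ k, (h (k, p)).2) := Prod.ext hp.1 rfl
  have h2 := hN (h (k, p)).2 (by omega)
  rw [← h1] at h2
  rw [Perm.mul_apply, Perm.mul_apply]
  exact ⟨h2.1, by rw [h2.2, hp.2]; ring⟩

theorem PermutesRays.pow {g : Perm (Rays n)} {σ : Perm (Fin n)} {m : Fin n → ℤ}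
    (hg : PermutesRays g σ m) (j : ℕ) : ∃ m', PermutesRays (g ^ j) (σ ^ j) m' := by
  induction j with
  | zero => exact ⟨0, .one⟩
  | succ j ih =>
    obtain ⟨m', hm'⟩ := ih
    exact ⟨_, by rw [pow_succ, pow_succ]; exact hm'.mul hg⟩

theorem PermutesRays.unique {g : Perm (Rays n)} {σ τ : Perm (Fin n)} {m m' : Fin n → ℤ}
    (h : PermutesRays g σ m) (h' : PermutesRays g τ m') : m = m' := by
  funext k
  obtain ⟨p, hp, hp'⟩ := ((h k).and (h' k)).exists
  have := hp.2.symm.trans hp'.2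
  omega

theorem mem_houghtonGroup_iff {g : Perm (Rays n)} :
    g ∈ houghtonGroup n ↔ ∃ m, PermutesRays g 1 m := by
  constructor
  · rintro ⟨m, K, hK, h⟩
    refine ⟨m, fun k => ?_⟩
    have hk : (Prod.mk k ⁻¹' K).Finite := hK.preimage (Prod.mk_right_injective k).injOn
    rw [← Nat.cofinite_eq_atTop]
    filter_upwards [hk.eventually_cofinite_notMem] with p hp
    exact h k p hp
  · rintro ⟨m, h⟩
    choose N hN using fun k => eventually_atTop.1 (h k)
    refine ⟨m, Set.univ ×ˢ Set.Iio (∑ k, N k), Set.finite_univ.prod (Set.finite_Iio _),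
      fun k p hkp => hN k p ?_⟩
    simp only [Set.mem_prod, Set.mem_univ, Set.mem_Iio, true_and, not_lt] at hkp
    exact (Finset.single_le_sum (fun _ _ => Nat.zero_le _) (Finset.mem_univ k)).trans hkp

theorem PermutesRays.inv {g : Perm (Rays n)} {m : Fin n → ℤ} (hg : PermutesRays g 1 m) :
    PermutesRays g⁻¹ 1 (-m) := by
  obtain ⟨m', hm'⟩ := mem_houghtonGroup_iff.1 (inv_mem (mem_houghtonGroup_iff.2 ⟨m, hg⟩))
  have h := hm'.mul hg
  rw [inv_mul_cancel] at h
  have h0 := h.unique .one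
  rwa [show m' = -m from funext fun k => by have := congrFun h0 k; simp at this ⊢; omega] at hm'

theorem swap_mem_houghtonGroup (x y : Rays n) : swap x y ∈ houghtonGroup n := by
  refine ⟨0, {x, y}, Set.toFinite _, fun k p hkp => ?_⟩
  simp only [Set.mem_insert_iff, Set.mem_singleton_iff, not_or] at hkp
  rw [swap_apply_of_ne_of_ne hkp.1 hkp.2]
  simp

/-- The initial segments of length `f k` of the rays. -/
def initialSegments (f : Fin n → ℕ) : Finset (Rays n) :=
  (Finset.univ.sigma fun k => Finset.range (f k)).map (sigmaEquivProd (Fin n) ℕ).toEmbedding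

theorem mem_initialSegments {f : Fin n → ℕ} {x : Rays n} :
    x ∈ initialSegments f ↔ x.2 < f x.1 := by
  simp [initialSegments]

theorem card_initialSegments (f : Fin n → ℕ) : (initialSegments f).card = ∑ k, f k := by
  simp [initialSegments]

/-- The translation lengths of an element of Houghton's group add up to zero. -/
theorem PermutesRays.sum_eq_zero {g : Perm (Rays n)} {m : Fin n → ℤ} (hg : PermutesRays g 1 m) :
    ∑ k, m k = 0 := by
  choose N hN using fun k => eventually_atTop.1 (hg k)
  obtain ⟨M, hM⟩ : ∃ M : ℕ, ∀ k, N k + (m k).natAbs ≤ M :=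
    ⟨∑ k, (N k + (m k).natAbs), fun k => Finset.single_le_sum
      (f := fun k => N k + (m k).natAbs) (fun _ _ => Nat.zero_le _) (Finset.mem_univ k)⟩
  -- `M` is so large that `g` is a translation from height `M` on and `M + m k` is nonnegative.
  -- Comparing the cardinalities of a finite set and its image then gives the sum.
  have key : (initialSegments fun _ => M).map g.toEmbedding =
      initialSegments fun k => (M + m k).toNat := by
    ext y
    obtain ⟨x, rfl⟩ := g.surjective y
    have : g x ∈ (initialSegments fun _ => M).map g.toEmbedding ↔
        x ∈ initialSegments fun _ => M := Finset.mem_map' g.toEmbedding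
    rw [this, mem_initialSegments, mem_initialSegments]
    constructor
    · intro hx
      by_contra hlt
      obtain ⟨k, hk⟩ : ∃ k, k = (g x).1 := ⟨_, rfl⟩
      rw [← hk] at hlt
      have hMk := hM k
      have h1 := hN k ((g x).2 - m k).toNat (by omega)
      have h2 : g (k, ((g x).2 - m k).toNat) = g x :=
        Prod.ext (h1.1.trans hk) (by have := h1.2; omega)
      have h3 := g.injective h2
      have h4 : x.2 = ((g x).2 - m k).toNat := by
        conv_lhs => rw [← h3]
      omega
    · intro hx
      by_contra hlt
      have hMk := hM x.1
      have h1 := hN x.1 x.2 (by omega)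
      have h2 : (g x).1 = x.1 := h1.1
      have h3 : ((g x).2 : ℤ) = x.2 + m x.1 := h1.2
      rw [h2] at hx
      omega
  have hcard := congrArg Finset.card key
  rw [Finset.card_map, card_initialSegments, card_initialSegments] at hcard
  have h5 : ((∑ _k : Fin n, M : ℕ) : ℤ) = ∑ k, ((M : ℤ) + m k) := by
    rw [hcard, Nat.cast_sum]
    refine Finset.sum_congr rfl fun k _ => ?_
    have hMk := hM k
    omega
  rw [Finset.sum_add_distrib, Nat.cast_sum] at h5
  omega

/-! ### Finite generation -/

/-- The map that moves the points of the ray `j` towards the ray `i` and those of the ray `i`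
away from it. -/
def shiftFun (i j : Fin n) (x : Rays n) : Rays n :=
  if x.1 = i then (i, x.2 + 1) else if x.1 = j then
    (if x.2 = 0 then (i, 0) else (j, x.2 - 1)) else x

theorem shiftFun_shiftFun {i j : Fin n} (hij : i ≠ j) (x : Rays n) :
    shiftFun j i (shiftFun i j x) = x := by
  obtain ⟨k, p⟩ := x
  unfold shiftFun
  grind

/-- The translation along the line formed by two rays. -/
def shift {i j : Fin n} (hij : i ≠ j) : Perm (Rays n) where
  toFun := shiftFun i j
  invFun := shiftFun j i
  left_inv := shiftFun_shiftFun hij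
  right_inv := shiftFun_shiftFun hij.symm

theorem shift_apply_left {i j : Fin n} (hij : i ≠ j) (p : ℕ) : shift hij (i, p) = (i, p + 1) := by
  simp [shift, shiftFun]

theorem permutesRays_shift {i j : Fin n} (hij : i ≠ j) :
    PermutesRays (shift hij) 1 (Pi.single i 1 - Pi.single j 1) := by
  intro k
  filter_upwards [eventually_ge_atTop 1] with p hp
  simp only [shift, shiftFun, Equiv.coe_fn_mk, Perm.one_apply, Pi.sub_apply, Pi.single_apply]
  by_cases hki : k = i
  · subst hki
    simp [hij]
  by_cases hkj : k = j
  · subst hkj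
    have : p ≠ 0 := by omega
    simp [hki, this]
    omega
  · simp [hki, hkj]

theorem shift_mem_houghtonGroup {i j : Fin n} (hij : i ≠ j) : shift hij ∈ houghtonGroup n :=
  mem_houghtonGroup_iff.2 ⟨_, permutesRays_shift hij⟩

/-- A finite generating set of Houghton's group. -/
def generators (n : ℕ) : Set (Perm (Rays n)) :=
  (Set.range fun k : Fin n => swap (k, 0) (k, 1)) ∪
    (Set.range fun a : Fin n × Fin n => swap (a.1, 0) (a.2, 0)) ∪
    Set.range fun a : {a : Fin n × Fin n // a.1 ≠ a.2} => shift a.2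

theorem finite_generators : (generators n).Finite :=
  ((Set.finite_range _).union (Set.finite_range _)).union (Set.finite_range _)

theorem shift_mem_closure {i j : Fin n} (hij : i ≠ j) :
    shift hij ∈ Subgroup.closure (generators n) :=
  Subgroup.subset_closure (Or.inr ⟨⟨(i, j), hij⟩, rfl⟩)

/-- Conjugation by a shift pushes an adjacent transposition outwards along its ray; transpositions
of the origins link different rays. -/
theorem swap_mem_closure (hn : 2 ≤ n) (x y : Rays n) :
    swap x y ∈ Subgroup.closure (generators n) := by
  have : Nontrivial (Fin n) := Fin.nontrivial_iff_two_le.2 hn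
  have h1 : ∀ (k : Fin n) (p : ℕ), swap (k, p) (k, p + 1) ∈ Subgroup.closure (generators n) := by
    intro k p
    obtain ⟨j, hj⟩ := exists_ne k
    induction p with
    | zero => exact Subgroup.subset_closure (Or.inl (Or.inl ⟨k, rfl⟩))
    | succ p ih =>
      have h := mul_mem (mul_mem (shift_mem_closure hj.symm) ih)
        (inv_mem (shift_mem_closure hj.symm))
      rwa [← swap_apply_apply, shift_apply_left, shift_apply_left] at h
  have h2 : ∀ (k : Fin n) (p : ℕ), swap (k, 0) (k, p) ∈ Subgroup.closure (generators n) := by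
    intro k p
    induction p with
    | zero => rw [swap_self]; exact one_mem _
    | succ p ih => exact SubmonoidClass.swap_mem_trans _ ih (h1 k p)
  refine SubmonoidClass.swap_mem_trans _ (b := (x.1, 0)) ?_
    (SubmonoidClass.swap_mem_trans _ (b := (y.1, 0)) ?_ (h2 y.1 y.2))
  · rw [swap_comm]; exact h2 x.1 x.2
  · exact Subgroup.subset_closure (Or.inl (Or.inr ⟨(x.1, y.1), rfl⟩))

theorem finite_compl_fixedBy {g : Perm (Rays n)} (hg : PermutesRays g 1 0) :
    (MulAction.fixedBy (Rays n) g)ᶜ.Finite := by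
  choose N hN using fun k => eventually_atTop.1 (hg k)
  refine (Set.finite_univ.prod (Set.finite_Iio (∑ k, N k))).subset fun x hx => ?_
  refine ⟨Set.mem_univ _, ?_⟩
  by_contra hlt
  have h1 : N x.1 ≤ ∑ k, N k :=
    Finset.single_le_sum (f := N) (fun _ _ => Nat.zero_le _) (Finset.mem_univ x.1)
  rw [Set.mem_Iio, not_lt] at hlt
  have h2 := hN x.1 x.2 (h1.trans hlt)
  refine hx (Prod.ext h2.1 ?_)
  have := h2.2
  simpa using this

theorem closure_generators (hn : 2 ≤ n) : Subgroup.closure (generators n) = houghtonGroup n := by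
  apply le_antisymm
  · rw [Subgroup.closure_le]
    rintro g ((⟨k, rfl⟩ | ⟨a, rfl⟩) | ⟨a, rfl⟩)
    · exact swap_mem_houghtonGroup _ _
    · exact swap_mem_houghtonGroup _ _
    · exact shift_mem_houghtonGroup _
  · intro g hg
    obtain ⟨m, hm⟩ := mem_houghtonGroup_iff.1 hg
    let V : AddSubgroup (Fin n → ℤ) :=
      { carrier := {v | ∃ s ∈ Subgroup.closure (generators n), PermutesRays s 1 v}
        zero_mem' := ⟨1, one_mem _, .one⟩
        add_mem' := by
          rintro v w ⟨s, hs, hv⟩ ⟨t, ht, hw⟩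
          exact ⟨t * s, mul_mem ht hs, hw.mul hv⟩
        neg_mem' := by
          rintro v ⟨s, hs, hv⟩
          exact ⟨s⁻¹, inv_mem hs, hv.inv⟩ }
    have i₀ : Fin n := ⟨0, by omega⟩
    have hV : ∀ i, (Pi.single i 1 - Pi.single i₀ 1 : Fin n → ℤ) ∈ V := by
      intro i
      by_cases hi : i = i₀
      · rw [hi, sub_self]; exact zero_mem V
      · exact ⟨_, shift_mem_closure hi, permutesRays_shift hi⟩
    have hmV : m ∈ V := by
      -- The correction terms at `i₀` cancel because the translation lengths sum to zero.
      have : m = ∑ i, m i • (Pi.single i 1 - Pi.single i₀ 1 : Fin n → ℤ) := by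
        simp only [smul_sub, Finset.sum_sub_distrib, ← Finset.sum_smul, hm.sum_eq_zero, zero_smul,
          sub_zero]
        funext k
        simp [Finset.sum_apply, Pi.single_apply]
      rw [this]
      exact sum_mem fun i _ => zsmul_mem (hV i) _
    obtain ⟨s, hs, hsm⟩ := hmV
    -- With its translation part removed, `g` has finite support and is a product of transpositions.
    have hgs : PermutesRays (g * s⁻¹) 1 0 := by
      have := hm.mul hsm.inv
      have h0 : (fun k => (-m) k + m ((1 : Perm (Fin n)) k)) = 0 := by funext k; simp
      rwa [h0] at this
    have h1 : g * s⁻¹ ∈ Subgroup.closure (generators n) := by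
      have h2 := mem_closure_isSwap'.2 (finite_compl_fixedBy hgs)
      refine (Subgroup.closure_le _).2 ?_ h2
      rintro _ ⟨x, y, -, rfl⟩
      exact swap_mem_closure hn x y
    simpa using mul_mem h1 hs

/-- Houghton's group on at least two rays is finitely generated. -/
theorem group_fg (hn : 2 ≤ n) : Group.FG (houghtonGroup n) := by
  rw [Group.fg_iff_subgroup_fg, Subgroup.fg_iff]
  exact ⟨generators n, closure_generators hn, finite_generators⟩

/-! ### The normalizer of the Houghton group -/

theorem exists_affine (hn : 2 ≤ n) {f : Perm (Rays n)}
    (hf : ∀ g ∈ houghtonGroup n, f * g * f⁻¹ ∈ houghtonGroup n) (i : Fin n) :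
    ∃ (a : Fin n) (c d : ℤ), 0 < d ∧
      ∀ᶠ p : ℕ in atTop, (f (i, p)).1 = a ∧ ((f (i, p)).2 : ℤ) = c + d * p := by
  have : Nontrivial (Fin n) := Fin.nontrivial_iff_two_le.2 hn
  obtain ⟨j, hj⟩ := exists_ne i
  obtain ⟨m, K, hK, hm⟩ := hf _ (shift_mem_houghtonGroup hj.symm)
  have hinj : Function.Injective fun p : ℕ => f (i, p) :=
    f.injective.comp (Prod.mk_right_injective i)
  have hev : ∀ᶠ p : ℕ in atTop, f (i, p) ∉ K := by
    rw [← Nat.cofinite_eq_atTop]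
    exact hinj.tendsto_cofinite.eventually hK.eventually_cofinite_notMem
  obtain ⟨P, hP⟩ := eventually_atTop.1 hev
  -- The conjugated shift sends `f (i, p)` to `f (i, p + 1)` and is a translation off `K`, so the
  -- image of the ray is eventually an arithmetic progression on one ray.
  have hstep : ∀ p, P ≤ p → (f (i, p + 1)).1 = (f (i, p)).1 ∧
      ((f (i, p + 1)).2 : ℤ) = (f (i, p)).2 + m (f (i, p)).1 := by
    intro p hp
    have h := hm (f (i, p)).1 (f (i, p)).2 (hP p hp)
    have h1 : (f * shift hj.symm * f⁻¹) ((f (i, p)).1, (f (i, p)).2) = f (i, p + 1) := by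
      simp [shift_apply_left]
    rwa [h1] at h
  have hiter : ∀ t : ℕ, (f (i, P + t)).1 = (f (i, P)).1 ∧
      ((f (i, P + t)).2 : ℤ) = (f (i, P)).2 + m (f (i, P)).1 * t := by
    intro t
    induction t with
    | zero => simp
    | succ t ih =>
      have h := hstep (P + t) (by omega)
      rw [ih.1, ih.2] at h
      rw [← Nat.add_assoc]
      exact ⟨h.1, by rw [h.2]; push_cast; ring⟩
  refine ⟨(f (i, P)).1, (f (i, P)).2 - m (f (i, P)).1 * P, m (f (i, P)).1, ?_, ?_⟩
  · by_contra hle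
    -- A negative slope would make the coordinate negative after `(f (i, P)).2 + 1` steps; slope
    -- zero contradicts injectivity.
    rcases (not_lt.1 hle).lt_or_eq with hlt | heq
    · have h := (hiter ((f (i, P)).2 + 1)).2
      push_cast at h
      nlinarith [Int.natCast_nonneg (f (i, P)).2,
        Int.natCast_nonneg (f (i, P + ((f (i, P)).2 + 1))).2]
    · have h := hiter 1
      rw [heq] at h
      have h1 : f (i, P + 1) = f (i, P) := Prod.ext h.1 (by have := h.2; simpa using this)
      have := hinj h1
      omega
  · filter_upwards [eventually_ge_atTop P] with p hp
    obtain ⟨t, rfl⟩ := Nat.exists_eq_add_of_le hp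
    refine ⟨(hiter t).1, ?_⟩
    rw [(hiter t).2]
    push_cast
    ring

/-- A permutation that normalizes Houghton's group permutes the rays up to finite sets. -/
theorem exists_permutesRays (hn : 2 ≤ n) {f : Perm (Rays n)}
    (hf : ∀ g ∈ houghtonGroup n, f * g * f⁻¹ ∈ houghtonGroup n)
    (hf' : ∀ g ∈ houghtonGroup n, f⁻¹ * g * f ∈ houghtonGroup n) :
    ∃ σ m, PermutesRays f σ m := by
  choose a c d hd h using exists_affine hn hf
  choose a' c' d' hd' h' using exists_affine hn (f := f⁻¹) (by simpa using hf')
  have key : ∀ i, a' (a i) = i ∧ d i = 1 := by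
    intro i
    obtain ⟨Q, hQ⟩ := eventually_atTop.1 (h' (a i))
    obtain ⟨P, hP⟩ := eventually_atTop.1 (h i)
    have hcomp : ∀ p, P + Q + (c i).natAbs ≤ p →
        a' (a i) = i ∧ (p : ℤ) = c' (a i) + d' (a i) * (c i + d i * p) := by
      intro p hp
      have h1 := hP p (by omega)
      have h2 : (Q : ℤ) ≤ (f (i, p)).2 := by
        rw [h1.2]
        have : (p : ℤ) ≤ d i * p := le_mul_of_one_le_left (by omega) (hd i)
        omega
      have h3 := hQ (f (i, p)).2 (by omega)
      have h4 : f⁻¹ (a i, (f (i, p)).2) = (i, p) := by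
        rw [Perm.inv_eq_iff_eq]
        exact Prod.ext h1.1.symm rfl
      rw [h4] at h3
      rw [← h1.2]
      exact ⟨h3.1.symm, h3.2⟩
    -- Subtracting the identity at two consecutive points gives `d' (a i) * d i = 1` in positive
    -- integers.
    have e1 := hcomp _ le_rfl
    have e2 := (hcomp (P + Q + (c i).natAbs + 1) (by omega)).2
    refine ⟨e1.1, ?_⟩
    have e3 := e1.2
    generalize P + Q + (c i).natAbs = p at e2 e3
    have e4 : d' (a i) * d i = 1 := by push_cast at e2; linarith
    nlinarith [hd i, hd' (a i)]
  have hinj : Function.Injective a := Function.LeftInverse.injective fun i => (key i).1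
  refine ⟨Equiv.ofBijective a (Finite.injective_iff_bijective.1 hinj), c, fun k => ?_⟩
  filter_upwards [h k] with p hp
  refine ⟨hp.1, ?_⟩
  rw [hp.2, (key k).2]
  ring

/-- A permutation that normalizes Houghton's group has a power in it. -/
theorem exists_pow_mem (hn : 2 ≤ n) {f : Perm (Rays n)}
    (hf : ∀ g ∈ houghtonGroup n, f * g * f⁻¹ ∈ houghtonGroup n)
    (hf' : ∀ g ∈ houghtonGroup n, f⁻¹ * g * f ∈ houghtonGroup n) :
    ∃ j, 0 < j ∧ f ^ j ∈ houghtonGroup n := by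
  obtain ⟨σ, m, h⟩ := exists_permutesRays hn hf hf'
  obtain ⟨m', h'⟩ := h.pow (orderOf σ)
  rw [pow_orderOf_eq_one] at h'
  exact ⟨orderOf σ, orderOf_pos σ, mem_houghtonGroup_iff.2 ⟨m', h'⟩⟩

end Translations

/-! ### Word length and growth rate -/

section WordLength

variable {G : Type*} [Group G] {A : Set G}

theorem wordLength_le (w : List G) (hw : ∀ x ∈ w, x ∈ A ∨ x⁻¹ ∈ A) :
    wordLength A w.prod ≤ w.length :=
  Nat.sInf_le ⟨w, hw, rfl, rfl⟩

theorem exists_word (hA : Subgroup.closure A = ⊤) (g : G) :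
    ∃ w : List G, (∀ x ∈ w, x ∈ A ∨ x⁻¹ ∈ A) ∧ w.prod = g ∧ w.length = wordLength A g := by
  have hg : g ∈ (Subgroup.closure A).toSubmonoid := by rw [hA]; exact Subgroup.mem_top g
  rw [Subgroup.closure_toSubmonoid] at hg
  obtain ⟨w, hw, hg⟩ := Submonoid.exists_list_of_mem_closure hg
  exact Nat.sInf_mem (s := {m : ℕ | ∃ w : List G, (∀ x ∈ w, x ∈ A ∨ x⁻¹ ∈ A) ∧ w.prod = g ∧
    w.length = m}) ⟨_, w, hw, hg, rfl⟩

theorem wordLength_mul_le (hA : Subgroup.closure A = ⊤) (g h : G) :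
    wordLength A (g * h) ≤ wordLength A g + wordLength A h := by
  obtain ⟨v, hv, hg, hvl⟩ := exists_word hA g
  obtain ⟨w, hw, hh, hwl⟩ := exists_word hA h
  have := wordLength_le (A := A) (v ++ w) fun x hx => by
    rcases List.mem_append.1 hx with hx | hx
    exacts [hv x hx, hw x hx]
  rwa [List.prod_append, List.length_append, hg, hh, hvl, hwl] at this

theorem one_le_wordLength (hA : Subgroup.closure A = ⊤) {g : G} (hg : g ≠ 1) :
    1 ≤ wordLength A g := by
  obtain ⟨w, -, hw, hl⟩ := exists_word hA g
  rw [← hl, Nat.one_le_iff_ne_zero]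
  intro h
  rw [List.length_eq_zero_iff] at h
  exact hg (by rw [← hw, h, List.prod_nil])

theorem wordLength_pow_mul_mul_pow_le (hA : Subgroup.closure A = ⊤) (h h' g : G) (k : ℕ) :
    wordLength A (h ^ k * g * h' ^ k) ≤
      k * (wordLength A h + wordLength A h') + wordLength A g := by
  induction k with
  | zero => simp
  | succ k ih =>
    have h1 : h ^ (k + 1) * g * h' ^ (k + 1) = h * (h ^ k * g * h' ^ k) * h' := by
      rw [pow_succ', pow_succ]; group
    rw [h1]
    have h2 := wordLength_mul_le hA (h * (h ^ k * g * h' ^ k)) h'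
    have h3 := wordLength_mul_le hA h (h ^ k * g * h' ^ k)
    have h4 : (k + 1) * (wordLength A h + wordLength A h') =
      k * (wordLength A h + wordLength A h') + wordLength A h + wordLength A h' := by ring
    omega

/-- If a power of `φ` is an inner automorphism, then the word length grows at most linearly along
the orbits of `φ`. -/
theorem exists_wordLength_iterate_le (hA : Subgroup.closure A = ⊤) (φ : G →* G) {m : ℕ}
    (hm : 0 < m) (h : G) (hφ : ∀ g, φ^[m] g = h * g * h⁻¹) (g : G) :
    ∃ C : ℕ, 0 < C ∧ ∀ k, wordLength A (φ^[k] g) ≤ C * (k + 1) := by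
  have hiter : ∀ q x, φ^[m * q] x = h ^ q * x * h⁻¹ ^ q := by
    intro q
    induction q with
    | zero => intro x; simp
    | succ q ih =>
      intro x
      rw [Nat.mul_succ, Function.iterate_add_apply, ih, hφ, pow_succ, pow_succ']
      group
  let B := ∑ r ∈ Finset.range m, wordLength A (φ^[r] g)
  refine ⟨wordLength A h + wordLength A h⁻¹ + B + 1, by omega, fun k => ?_⟩
  have hr : wordLength A (φ^[k % m] g) ≤ B :=
    Finset.single_le_sum (f := fun r => wordLength A (φ^[r] g)) (fun _ _ => Nat.zero_le _)
      (Finset.mem_range.2 (Nat.mod_lt k hm))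
  have hk : φ^[k] g = h ^ (k / m) * (φ^[k % m] g) * h⁻¹ ^ (k / m) := by
    rw [← hiter, ← Function.iterate_add_apply, Nat.div_add_mod]
  rw [hk]
  calc _ ≤ k / m * (wordLength A h + wordLength A h⁻¹) + wordLength A (φ^[k % m] g) :=
        wordLength_pow_mul_mul_pow_le hA _ _ _ _
    _ ≤ k * (wordLength A h + wordLength A h⁻¹) + B :=
        Nat.add_le_add (Nat.mul_le_mul_right _ (Nat.div_le_self k m)) hr
    _ ≤ _ := by nlinarith [Nat.zero_le (k * B), Nat.zero_le k]

theorem tendsto_linear_rpow_inv {C : ℕ} (hC : 0 < C) :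
    Tendsto (fun k : ℕ => ((C * (k + 1) : ℕ) : ℝ≥0∞) ^ (1 / (k : ℝ))) atTop (nhds 1) := by
  have hC' : (0 : ℝ) < C := by exact_mod_cast hC
  -- With `x = C * (k + 1)`, the constants `1 / C` and `-1` give `x / C - 1 = k`, the required root.
  have h1 := tendsto_rpow_div_mul_add 1 (1 / (C : ℝ)) (-1) (by positivity)
  have h2 : Tendsto (fun k : ℕ => (C : ℝ) * (k + 1)) atTop atTop :=
    (tendsto_atTop_add_const_right _ 1 tendsto_natCast_atTop_atTop).const_mul_atTop hC'
  have h3 := ENNReal.tendsto_ofReal (h1.comp h2)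
  rw [ENNReal.ofReal_one] at h3
  refine h3.congr fun k => ?_
  have h4 : 1 / (C : ℝ) * (C * (k + 1)) + -1 = k := by field_simp; ring
  rw [Function.comp_apply, h4, ← ENNReal.ofReal_rpow_of_pos (by positivity)]
  congr 1
  rw [← ENNReal.ofReal_natCast]
  push_cast
  rfl

/-- An injective endomorphism of a nontrivial group, a power of which is inner, has growth
rate `1`. -/
theorem growthRate_eq_one [Nontrivial G] (hA : Subgroup.closure A = ⊤) (φ : G →* G)
    (hinj : Function.Injective φ) {m : ℕ} (hm : 0 < m) (h : G)
    (hφ : ∀ g, φ^[m] g = h * g * h⁻¹) : growthRate A φ = 1 := by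
  apply le_antisymm
  · refine iSup_le fun g => ?_
    obtain ⟨C, hC, hk⟩ := exists_wordLength_iterate_le hA φ hm h hφ g
    rw [← (tendsto_linear_rpow_inv hC).limsup_eq]
    refine limsup_le_limsup (Eventually.of_forall fun k => ?_)
    exact ENNReal.rpow_le_rpow (by exact_mod_cast hk k) (by positivity)
  · obtain ⟨g, hg⟩ := exists_ne (1 : G)
    refine le_trans ?_ (le_iSup _ g)
    refine le_limsup_of_frequently_le (Eventually.frequently (Eventually.of_forall fun k => ?_))
    have hk : φ^[k] g ≠ 1 := by
      intro h1
      exact hg (hinj.iterate k (h1.trans (iterate_map_one φ k).symm))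
    have : (1 : ℝ≥0∞) ≤ wordLength A (φ^[k] g) := by exact_mod_cast one_le_wordLength hA hk
    calc (1 : ℝ≥0∞) = 1 ^ (1 / (k : ℝ)) := (ENNReal.one_rpow _).symm
      _ ≤ _ := ENNReal.rpow_le_rpow this (by positivity)

end WordLength

/-! ### Automorphisms of the Houghton group -/

section Automorphisms

variable {n : ℕ}

theorem infinite_rays (hn : 0 < n) : Infinite (Rays n) :=
  have : Nonempty (Fin n) := ⟨⟨0, hn⟩⟩
  inferInstance

theorem nontrivial_houghtonGroup (hn : 0 < n) : Nontrivial (houghtonGroup n) := by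
  refine ⟨⟨1, ⟨swap (⟨0, hn⟩, 0) (⟨0, hn⟩, 1), swap_mem_houghtonGroup _ _⟩, fun h => ?_⟩⟩
  have h1 := congrArg (fun g : houghtonGroup n => (g : Perm (Rays n)) (⟨0, hn⟩, 0)) h
  simp at h1

/-- An involution in Houghton's group has a fixed point. -/
theorem exists_apply_eq_of_mul_self (hn : 0 < n) {t : Perm (Rays n)} (ht : t ∈ houghtonGroup n)
    (h2 : t * t = 1) : ∃ e, t e = e := by
  obtain ⟨m, hm⟩ := mem_houghtonGroup_iff.1 ht
  have h := hm.mul hm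
  rw [h2] at h
  -- Twice the translation length vanishes, so far-out points of the ray are fixed.
  have h0 := congrFun (h.unique .one) ⟨0, hn⟩
  obtain ⟨p, hp⟩ := (hm ⟨0, hn⟩).exists
  refine ⟨_, Prod.ext hp.1 ?_⟩
  have := hp.2
  simp only [Perm.one_apply, Pi.zero_apply] at h0
  omega

/-- Automorphisms of Houghton's group map transpositions to transpositions. -/
theorem isSwap_map (hn : 0 < n) (φ : houghtonGroup n ≃* houghtonGroup n) {g : houghtonGroup n}
    (hg : (g : Perm (Rays n)).IsSwap) : (φ g : Perm (Rays n)).IsSwap := by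
  obtain ⟨x, y, hxy, hgs⟩ := hg
  have h2 : g * g = 1 := Subtype.ext (by simp [hgs])
  have h2' : (φ g : Perm (Rays n)) * φ g = 1 := by
    have := congrArg φ h2
    rw [map_mul, map_one] at this
    exact congrArg Subtype.val this
  obtain ⟨e, he⟩ := exists_apply_eq_of_mul_self hn (φ g).2 h2'
  refine isSwap_of_mul_conj_pow_six (G := houghtonGroup n) swap_mem_houghtonGroup ?_ h2' he ?_
  · intro h1
    have h3 : φ g = φ 1 := by rw [map_one]; exact Subtype.ext h1
    have h4 := congrArg (fun s : houghtonGroup n => (s : Perm (Rays n)) x) (φ.injective h3)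
    simp only [hgs, swap_apply_left, Subgroup.coe_one, Perm.one_apply] at h4
    exact hxy h4.symm
  · intro u hu
    -- By surjectivity every conjugate of `φ g` is the image of a conjugate of `g`, so the order
    -- condition transfers.
    obtain ⟨v, hv⟩ := φ.surjective ⟨u, hu⟩
    have h3 : (g * (v * g * v⁻¹)) ^ 6 = 1 := by
      apply Subtype.ext
      push_cast
      rw [hgs, ← swap_apply_apply]
      exact swap_mul_swap_pow_six _ _ _ _
    have h4 := congrArg (fun s => (φ s : Perm (Rays n))) h3
    simpa [hv] using h4

/-- A power of each automorphism of Houghton's group is inner. -/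
theorem exists_iterate_eq_conj (hn : 2 ≤ n) (φ : houghtonGroup n ≃* houghtonGroup n) :
    ∃ j, 0 < j ∧ ∃ h : houghtonGroup n, ∀ g, φ^[j] g = h * g * h⁻¹ := by
  have := infinite_rays (n := n) (by omega)
  obtain ⟨f, hf⟩ := exists_conj_of_isSwap_iff swap_mem_houghtonGroup φ fun g =>
    ⟨fun h => by simpa using isSwap_map (by omega) φ.symm h, isSwap_map (by omega) φ⟩
  obtain ⟨j, hj, hmem⟩ := exists_pow_mem hn (f := f)
    (fun g hg => by
      rw [← hf ⟨g, hg⟩]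
      exact (φ ⟨g, hg⟩).2)
    (fun g hg => by
      obtain ⟨v, hv⟩ := φ.surjective ⟨g, hg⟩
      have h := hf v
      rw [hv] at h
      change g = _ at h
      have h1 : f⁻¹ * g * f = v := by
        rw [h]
        group
      rw [h1]
      exact v.2)
  have hpow : ∀ k g, ((φ^[k] g : houghtonGroup n) : Perm (Rays n)) = f ^ k * g * (f ^ k)⁻¹ := by
    intro k g
    induction k with
    | zero => simp
    | succ k ih =>
      rw [Function.iterate_succ_apply', hf, ih, pow_succ']
      group
  exact ⟨j, hj, ⟨f ^ j, hmem⟩, fun g => Subtype.ext (hpow j g)⟩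

end Automorphisms

end Houghton

theorem mainTheorem5 (n : ℕ) (hn : 3 ≤ n)
    (φ : Houghton.houghtonGroup n ≃* Houghton.houghtonGroup n) :
    Group.FG (Houghton.houghtonGroup n) ∧
      ∀ A : Set (Houghton.houghtonGroup n), A.Finite → Subgroup.closure A = ⊤ →
        Houghton.growthRate A φ.toMonoidHom = 1 := by
  refine ⟨Houghton.group_fg (by omega), fun A _ hA => ?_⟩
  have := Houghton.nontrivial_houghtonGroup (n := n) (by omega)
  obtain ⟨j, hj, h, hφ⟩ := Houghton.exists_iterate_eq_conj (by omega) φ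
  exact Houghton.growthRate_eq_one hA φ.toMonoidHom φ.injective hj h hφ
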